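/- A $\mathbb{Z}_4$-code of length $n$ is a $\mathbb{Z}_4$-submodule $C$ of $\mathbb{Z}_4^n$; its residue code is the binary linear code $C^{(1)}=\{c \bmod 2 \mid c\in C\}$. Two $\mathbb{Z}_4$-codes are equivalent if one is obtained from the other by permuting the coordinates and changing the signs of certain coordinates; two binary codes are equivalent if one is obtained from the other by permuting the coordinates. The Euclidean weight of $x\in\mathbb{Z}_4^n$ is $n_1(x)+4n_2(x)+n_3(x)$, where $n_\alpha(x)$ is the number of coordinates of $x$ equal to $\alpha$. The code $C$ is Type II if it is self-dual for the inner product $\sum_i x_iy_i$ and the Euclidean weights of all its codewords are divisible by $8$; a Type II code is extremal if the smallest Euclidean weight of its nonzero codewords equals $8\lfloor n/24\rfloor+8$. Let $RM(1,5)$ be the first order Reed–Muller code of length $32$, i.e. the binary code spanned by $1^{32}$, $1^{16}0^{16}$, $(1^80^8)^2$, $(1^40^4)^4$, $(1100)^8$ and $(10)^{16}$, where exponents denote repetition. Proposition 3. Up to equivalence, there is exactly one extremal Type II $\mathbb{Z}_4$-code of length $32$ whose residue code has dimension $6$. It has a representative whose residue code is equal to $RM(1,5)$, and the residue code of every such code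 is equivalent to $RM(1,5)$. -/

import Mathlib

/-- A `ℤ₄`-code of length `n`: a `ℤ₄`-submodule of `ℤ₄ⁿ`. -/
abbrev Z4Code (n : ℕ) : Type := Submodule (ZMod 4) (Fin n → ZMod 4)

/-- A binary linear code of length `n`. -/
abbrev BinaryCode (n : ℕ) : Type := Submodule (ZMod 2) (Fin n → ZMod 2)

namespace Z4Code

variable {n : ℕ}

/-- The dual code with respect to the standard inner product `x₁y₁ + ⋯ + xₙyₙ`. -/
def dual (C : Z4Code n) : Z4Code n where
  carrier := {x | ∀ y ∈ C, ∑ i, x i * y i = 0}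
  zero_mem' := by
    intro y _
    simp
  add_mem' := by
    intro a b ha hb y hy
    simp [add_mul, Finset.sum_add_distrib, ha y hy, hb y hy]
  smul_mem' := by
    intro r a ha y hy
    simp [mul_assoc, ← Finset.mul_sum, ha y hy]

/-- `C` is self-dual if it equals its dual. -/
def IsSelfDual (C : Z4Code n) : Prop := C = C.dual

/-- The number of coordinates of `x` that are equal to `a`. -/
def countOf (a : ZMod 4) (x : Fin n → ZMod 4) : ℕ :=
  (Finset.univ.filter fun i => x i = a).card

/-- The Euclidean weight `n₁(x) + 4 n₂(x) + n₃(x)`. -/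
def euclideanWeight (x : Fin n → ZMod 4) : ℕ :=
  countOf 1 x + 4 * countOf 2 x + countOf 3 x

/-- The minimum Euclidean weight: the smallest Euclidean weight among the nonzero codewords
(with value `0` for the zero code, which has none). -/
noncomputable def minEuclideanWeight (C : Z4Code n) : ℕ :=
  sInf {w | ∃ x ∈ C, x ≠ 0 ∧ euclideanWeight x = w}

/-- Type II: self-dual, with all Euclidean weights divisible by `8`. -/
def IsTypeII (C : Z4Code n) : Prop :=
  C.IsSelfDual ∧ ∀ x ∈ C, 8 ∣ euclideanWeight x

/-- Extremal Type II: the minimum Euclidean weight is `8 ⌊n/24⌋ + 8`. -/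
def IsExtremalTypeII (C : Z4Code n) : Prop :=
  C.IsTypeII ∧ C.minEuclideanWeight = 8 * (n / 24) + 8

/-- Equivalence: `D` is obtained from `C` by permuting the coordinates and changing the signs
of certain coordinates. -/
def Equivalent (C D : Z4Code n) : Prop :=
  ∃ (σ : Equiv.Perm (Fin n)) (ε : Fin n → ℤˣ),
    (D : Set (Fin n → ZMod 4)) =
      (fun (x : Fin n → ZMod 4) (i : Fin n) => (((ε i : ℤˣ) : ℤ) : ZMod 4) * x (σ i)) ''
        (C : Set (Fin n → ZMod 4))

/-- Coordinatewise reduction modulo `2`. -/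
def reduceModTwo (x : Fin n → ZMod 4) : Fin n → ZMod 2 :=
  fun i => ZMod.castHom (show 2 ∣ 4 by norm_num) (ZMod 2) (x i)

/-- The residue code `{c mod 2 | c ∈ C}`. -/
def residue (C : Z4Code n) : BinaryCode n where
  carrier := {b | ∃ c ∈ C, reduceModTwo c = b}
  zero_mem' := ⟨0, C.zero_mem, by
    funext i
    simp only [reduceModTwo, Pi.zero_apply, map_zero]⟩
  add_mem' := by
    rintro _ _ ⟨c, hc, rfl⟩ ⟨d, hd, rfl⟩
    refine ⟨c + d, C.add_mem hc hd, ?_⟩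
    funext i
    simp only [reduceModTwo, Pi.add_apply, map_add]
  smul_mem' := by
    rintro r _ ⟨c, hc, rfl⟩
    refine ⟨(r.val : ZMod 4) • c, C.smul_mem _ hc, ?_⟩
    funext i
    simp only [reduceModTwo, Pi.smul_apply, smul_eq_mul, map_mul, map_natCast,
      ZMod.natCast_zmod_val]

end Z4Code

namespace BinaryCode

/-- Equivalence of binary codes: `B'` is obtained from `B` by permuting the coordinates. -/
def Equivalent {n : ℕ} (B B' : BinaryCode n) : Prop :=
  ∃ σ : Equiv.Perm (Fin n),
    (B' : Set (Fin n → ZMod 2)) =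
      (fun (x : Fin n → ZMod 2) (i : Fin n) => x (σ i)) '' (B : Set (Fin n → ZMod 2))

/-- The generator matrix of `RM(1,5)` with first row all ones; for `j = 1, …, 5` row `j` has a
`1` in coordinate `i ∈ {0, …, 31}` exactly when the binary digit of `i` of weight `2 ^ (5 - j)`
is `0`, so the rows are `1³²`, `1¹⁶0¹⁶`, `(1⁸0⁸)²`, `(1⁴0⁴)⁴`, `(1100)⁸`, `(10)¹⁶`. -/
def rmGenerator : Fin 6 → Fin 32 → ZMod 2 :=
  ![fun _ => 1,
    fun i => if i.val.testBit 4 then 0 else 1,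
    fun i => if i.val.testBit 3 then 0 else 1,
    fun i => if i.val.testBit 2 then 0 else 1,
    fun i => if i.val.testBit 1 then 0 else 1,
    fun i => if i.val.testBit 0 then 0 else 1]

/-- The first order Reed–Muller code `RM(1,5)` of length `32`. -/
def rmOneFive : BinaryCode 32 := Submodule.span (ZMod 2) (Set.range rmGenerator)

end BinaryCode

/-! In a self-dual code the words `2t` are exactly those with `t` orthogonal to the residue code.
Type II makes every such `t` even, so the residue code contains the all-one word. Minimum weight
above 8 excludes `t` of weight 2, so the residue code separates the coordinates. In dimension 6 only
2⁵ = 32 columns are then possible, each occurs once, and the residue code is a permuted RM(1,5)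
(`IsTypeII.residue_equivalent_rmOneFive`).

For codes with residue RM(1,5), compare lifts `c j` and `d j = c j + 2 u j` of the generators `r j`.
The binary matrix `B i j = u i · r j` is symmetric by self-duality, and weights modulo 8 force `B i
i = B 0 i`. Changing signs on a set `S` contributes the matrix `∑ S (r i) (r j)`. The monomials of
degree at most two in the `r j` are independent, so some `S` realises `B`
(`exists_sum_mul_rmGenerator_mul_eq`), and the codes agree after this sign change
(`IsTypeII.exists_map_signOf_eq`).

Existence is witnessed by `rmCode`, generated by the 0/1 lifts of the generators and the doubled
dual of RM(1,5). -/

/-- Multiplication by two, as a map `ℤ₂ → ℤ₄`. -/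
def twoHom : ZMod 2 →+ ZMod 4 where
  toFun a := 2 * (a.val : ZMod 4)
  map_zero' := by decide
  map_add' := by decide

/-- Multiplication by two, as a map `ℤ₄ → ℤ₈`. -/
def twoHomEight : ZMod 4 →+ ZMod 8 where
  toFun a := 2 * (a.val : ZMod 8)
  map_zero' := by decide
  map_add' := by decide

/-- Multiplication by four, as a map `ℤ₂ → ℤ₈`. -/
def fourHom : ZMod 2 →+ ZMod 8 where
  toFun a := 4 * (a.val : ZMod 8)
  map_zero' := by decide
  map_add' := by decide

/-- Reduction modulo two. -/
abbrev redHom : ZMod 4 →+* ZMod 2 := ZMod.castHom (show 2 ∣ 4 by norm_num) (ZMod 2)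

/-- The square of an element of `ℤ₄`, well defined modulo `8`. -/
def sqEight (x : ZMod 4) : ZMod 8 := (x.val : ZMod 8) ^ 2

theorem twoHom_mul : ∀ (a : ZMod 2) (x : ZMod 4), twoHom a * x = twoHom (a * redHom x) := by
  decide

theorem twoHom_eq_zero : ∀ a : ZMod 2, twoHom a = 0 ↔ a = 0 := by decide

theorem fourHom_eq_zero : ∀ a : ZMod 2, fourHom a = 0 ↔ a = 0 := by decide

theorem redHom_twoHom : ∀ a : ZMod 2, redHom (twoHom a) = 0 := by decide

theorem exists_twoHom_of_redHom_eq_zero : ∀ x : ZMod 4, redHom x = 0 → ∃ a, x = twoHom a := by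
  decide

theorem sqEight_add : ∀ x y : ZMod 4,
    sqEight (x + y) = sqEight x + sqEight y + twoHomEight (x * y) := by decide

theorem sqEight_mul : ∀ x y : ZMod 4, sqEight (x * y) = sqEight x * sqEight y := by decide

theorem sqEight_add_twoHom : ∀ (x : ZMod 4) (a : ZMod 2),
    sqEight (x + twoHom a) = sqEight x + fourHom (a * redHom x + a) := by decide

theorem sqEight_twoHom : ∀ a : ZMod 2, sqEight (twoHom a) = fourHom a := by decide

/-! ### Doubled words, Euclidean weight modulo 8, and signed permutations. -/

namespace Z4Code

variable {n : ℕ}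

/-- The word `2t` of `ℤ₄ⁿ` attached to a binary word `t`. -/
def double (t : Fin n → ZMod 2) : Fin n → ZMod 4 := fun i => twoHom (t i)

@[simp] theorem reduceModTwo_apply (x : Fin n → ZMod 4) (i : Fin n) :
    reduceModTwo x i = redHom (x i) := rfl

theorem reduceModTwo_add (x y : Fin n → ZMod 4) :
    reduceModTwo (x + y) = reduceModTwo x + reduceModTwo y := by
  funext i; simp [reduceModTwo]

theorem reduceModTwo_sub (x y : Fin n → ZMod 4) :
    reduceModTwo (x - y) = reduceModTwo x - reduceModTwo y := by
  funext i; simp [reduceModTwo]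

theorem reduceModTwo_double (t : Fin n → ZMod 2) : reduceModTwo (double t) = 0 := by
  funext i; exact redHom_twoHom _

theorem double_ne_zero {t : Fin n → ZMod 2} (ht : t ≠ 0) : double t ≠ 0 := by
  intro h
  exact ht (funext fun i => (twoHom_eq_zero _).1 (congrFun h i))

theorem exists_double_of_reduceModTwo_eq_zero {x : Fin n → ZMod 4} (h : reduceModTwo x = 0) :
    ∃ t, x = double t := by
  choose t ht using fun i => exists_twoHom_of_redHom_eq_zero (x i) (congrFun h i)
  exact ⟨t, funext ht⟩

theorem exists_add_double {x y : Fin n → ZMod 4} (h : reduceModTwo x = reduceModTwo y) :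
    ∃ t, x = y + double t := by
  obtain ⟨t, ht⟩ := exists_double_of_reduceModTwo_eq_zero (x := x - y)
    (by rw [reduceModTwo_sub, h, sub_self])
  exact ⟨t, by rw [← ht]; abel⟩

theorem sum_double_mul (t : Fin n → ZMod 2) (y : Fin n → ZMod 4) :
    ∑ i, double t i * y i = twoHom (∑ i, t i * reduceModTwo y i) := by
  rw [map_sum]
  exact Finset.sum_congr rfl fun i _ => twoHom_mul _ _

theorem mem_residue {C : Z4Code n} {b : Fin n → ZMod 2} :
    b ∈ C.residue ↔ ∃ c ∈ C, reduceModTwo c = b := Iff.rfl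

theorem reduceModTwo_mem_residue {C : Z4Code n} {x : Fin n → ZMod 4} (hx : x ∈ C) :
    reduceModTwo x ∈ C.residue := ⟨x, hx, rfl⟩

theorem IsSelfDual.sum_mul_eq_zero {C : Z4Code n} (hC : C.IsSelfDual) {x y : Fin n → ZMod 4}
    (hx : x ∈ C) (hy : y ∈ C) : ∑ i, x i * y i = 0 := by
  rw [hC] at hx
  exact hx y hy

/-- The torsion code of a self-dual code is the dual of its residue code. -/
theorem IsSelfDual.double_mem_iff {C : Z4Code n} (hC : C.IsSelfDual) {t : Fin n → ZMod 2} :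
    double t ∈ C ↔ ∀ r ∈ C.residue, ∑ i, t i * r i = 0 := by
  constructor
  · rintro h _ ⟨c, hc, rfl⟩
    have := hC.sum_mul_eq_zero h hc
    rwa [sum_double_mul, twoHom_eq_zero] at this
  · intro h
    rw [hC]
    intro y hy
    rw [sum_double_mul, h _ (reduceModTwo_mem_residue hy), map_zero]

/-- The Euclidean weight modulo `8`. -/
def norm8 (x : Fin n → ZMod 4) : ZMod 8 := ∑ i, sqEight (x i)

theorem euclideanWeight_eq_sum (x : Fin n → ZMod 4) :
    euclideanWeight x = ∑ i, ((if x i = 1 then 1 else 0) + 4 * (if x i = 2 then 1 else 0) +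
      (if x i = 3 then 1 else 0)) := by
  simp only [euclideanWeight, countOf, Finset.card_filter, Finset.sum_add_distrib,
    Finset.mul_sum]

theorem cast_euclideanWeight (x : Fin n → ZMod 4) : (euclideanWeight x : ZMod 8) = norm8 x := by
  rw [euclideanWeight_eq_sum, Nat.cast_sum, norm8]
  refine Finset.sum_congr rfl fun i _ => ?_
  generalize x i = a
  revert a
  decide

theorem eight_dvd_euclideanWeight_iff (x : Fin n → ZMod 4) :
    8 ∣ euclideanWeight x ↔ norm8 x = 0 := by
  rw [← cast_euclideanWeight, ZMod.natCast_eq_zero_iff]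

/-- Polarisation: norm zero passes from mutually orthogonal generators to their span. -/
theorem norm8_add (x y : Fin n → ZMod 4) :
    norm8 (x + y) = norm8 x + norm8 y + twoHomEight (∑ i, x i * y i) := by
  simp only [norm8, Pi.add_apply, sqEight_add, Finset.sum_add_distrib, map_sum]

theorem norm8_smul (a : ZMod 4) (x : Fin n → ZMod 4) : norm8 (a • x) = sqEight a * norm8 x := by
  simp only [norm8, Pi.smul_apply, smul_eq_mul, sqEight_mul, Finset.mul_sum]

/-- Coordinatewise `(x + 2a)² = x² + 4(ax + a²)`, and `a² = a` modulo 2. -/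
theorem norm8_add_double (x : Fin n → ZMod 4) (t : Fin n → ZMod 2) :
    norm8 (x + double t) = norm8 x + fourHom (∑ i, t i * reduceModTwo x i + ∑ i, t i) := by
  simp only [norm8, Pi.add_apply, double, sqEight_add_twoHom, ← Finset.sum_add_distrib, map_sum]
  rfl

theorem norm8_double (t : Fin n → ZMod 2) : norm8 (double t) = fourHom (∑ i, t i) := by
  simp only [norm8, double, sqEight_twoHom, map_sum]

theorem card_support_le_euclideanWeight (x : Fin n → ZMod 4) :
    (Finset.univ.filter fun i => reduceModTwo x i ≠ 0).card ≤ euclideanWeight x := by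
  rw [euclideanWeight_eq_sum, Finset.card_filter]
  refine Finset.sum_le_sum fun i _ => ?_
  rw [reduceModTwo_apply]
  generalize x i = a
  revert a
  decide

theorem euclideanWeight_double (t : Fin n → ZMod 2) :
    euclideanWeight (double t) = 4 * (Finset.univ.filter fun i => t i ≠ 0).card := by
  have key : ∀ a : ZMod 2, (if twoHom a = 1 then 1 else 0) + 4 * (if twoHom a = 2 then 1 else 0) +
      (if twoHom a = 3 then 1 else 0) = 4 * (if a ≠ 0 then 1 else 0) := by decide
  rw [euclideanWeight_eq_sum, Finset.card_filter, Finset.mul_sum]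
  exact Finset.sum_congr rfl fun i _ => key (t i)

theorem eq_zero_of_euclideanWeight_eq_zero {x : Fin n → ZMod 4} (h : euclideanWeight x = 0) :
    x = 0 := by
  rw [euclideanWeight_eq_sum, Finset.sum_eq_zero_iff] at h
  funext i
  have := h i (Finset.mem_univ i)
  revert this
  rw [Pi.zero_apply]
  generalize x i = a
  revert a
  decide

theorem IsTypeII.norm8_eq_zero {C : Z4Code n} (hC : C.IsTypeII) {x : Fin n → ZMod 4}
    (hx : x ∈ C) : norm8 x = 0 := (eight_dvd_euclideanWeight_iff x).1 (hC.2 x hx)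

/-- A self-dual code contained in another one is equal to it. -/
theorem IsSelfDual.eq_of_le {C D : Z4Code n} (hC : C.IsSelfDual) (hD : D.IsSelfDual)
    (h : D ≤ C) : D = C := by
  refine le_antisymm h fun x hx => ?_
  rw [hD]
  exact fun y hy => hC.sum_mul_eq_zero hx (h hy)

/-- A signed permutation of the coordinates. -/
def signedPerm (σ : Equiv.Perm (Fin n)) (ε : Fin n → ℤˣ) :
    (Fin n → ZMod 4) →ₗ[ZMod 4] (Fin n → ZMod 4) where
  toFun x i := ((ε i : ℤ) : ZMod 4) * x (σ i)
  map_add' x y := by funext i; simp [mul_add]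
  map_smul' a x := by funext i; simp [mul_left_comm]

@[simp] theorem signedPerm_apply (σ : Equiv.Perm (Fin n)) (ε : Fin n → ℤˣ) (x : Fin n → ZMod 4)
    (i : Fin n) : signedPerm σ ε x i = ((ε i : ℤ) : ZMod 4) * x (σ i) := rfl

theorem intUnit_mul_self (e : ℤˣ) : ((e : ℤ) : ZMod 4) * ((e : ℤ) : ZMod 4) = 1 := by
  rcases Int.units_eq_one_or e with rfl | rfl <;> decide

theorem sum_signedPerm_mul (σ : Equiv.Perm (Fin n)) (ε : Fin n → ℤˣ) (x y : Fin n → ZMod 4) :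
    ∑ i, signedPerm σ ε x i * signedPerm σ ε y i = ∑ i, x i * y i := by
  rw [← Equiv.sum_comp σ (fun i => x i * y i)]
  refine Finset.sum_congr rfl fun i _ => ?_
  rw [signedPerm_apply, signedPerm_apply, mul_mul_mul_comm, intUnit_mul_self, one_mul]

theorem norm8_signedPerm (σ : Equiv.Perm (Fin n)) (ε : Fin n → ℤˣ) (x : Fin n → ZMod 4) :
    norm8 (signedPerm σ ε x) = norm8 x := by
  rw [norm8, norm8, ← Equiv.sum_comp σ (fun i => sqEight (x i))]
  refine Finset.sum_congr rfl fun i _ => ?_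
  rw [signedPerm_apply, sqEight_mul]
  rcases Int.units_eq_one_or (ε i) with h | h <;> rw [h]
  · exact one_mul _
  · exact one_mul _

theorem signedPerm_surjective (σ : Equiv.Perm (Fin n)) (ε : Fin n → ℤˣ) :
    Function.Surjective (signedPerm σ ε) := by
  intro y
  refine ⟨fun i => ((ε (σ.symm i) : ℤ) : ZMod 4) * y (σ.symm i), funext fun i => ?_⟩
  simp [← mul_assoc, intUnit_mul_self]

theorem IsTypeII.map_signedPerm {C : Z4Code n} (hC : C.IsTypeII) (σ : Equiv.Perm (Fin n))
    (ε : Fin n → ℤˣ) : IsTypeII (Submodule.map (signedPerm σ ε) C) := by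
  refine ⟨le_antisymm ?_ ?_, ?_⟩
  · rintro _ ⟨x, hx, rfl⟩ _ ⟨y, hy, rfl⟩
    rw [sum_signedPerm_mul]
    exact hC.1.sum_mul_eq_zero hx hy
  · intro z hz
    obtain ⟨x, rfl⟩ := signedPerm_surjective σ ε z
    refine ⟨x, ?_, rfl⟩
    rw [SetLike.mem_coe, hC.1]
    intro y hy
    rw [← sum_signedPerm_mul σ ε]
    exact hz _ ⟨y, hy, rfl⟩
  · rintro _ ⟨x, hx, rfl⟩
    rw [eight_dvd_euclideanWeight_iff, norm8_signedPerm]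
    exact hC.norm8_eq_zero hx

theorem reduceModTwo_signedPerm (σ : Equiv.Perm (Fin n)) (ε : Fin n → ℤˣ)
    (x : Fin n → ZMod 4) : reduceModTwo (signedPerm σ ε x) = fun i => reduceModTwo x (σ i) := by
  funext i
  rw [reduceModTwo_apply, signedPerm_apply, reduceModTwo_apply, map_mul]
  rcases Int.units_eq_one_or (ε i) with h | h <;> rw [h] <;> exact one_mul _

theorem coe_residue_map_signedPerm (C : Z4Code n) (σ : Equiv.Perm (Fin n)) (ε : Fin n → ℤˣ) :
    (residue (Submodule.map (signedPerm σ ε) C) : Set (Fin n → ZMod 2)) =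
      (fun (x : Fin n → ZMod 2) (i : Fin n) => x (σ i)) '' (C.residue : Set (Fin n → ZMod 2)) := by
  ext b
  constructor
  · rintro ⟨_, ⟨x, hx, rfl⟩, rfl⟩
    exact ⟨_, reduceModTwo_mem_residue hx, (reduceModTwo_signedPerm σ ε x).symm⟩
  · rintro ⟨_, ⟨x, hx, rfl⟩, rfl⟩
    exact ⟨_, ⟨x, hx, rfl⟩, reduceModTwo_signedPerm σ ε x⟩

end Z4Code

/-! ### Binary duality and the combinatorics of RM(1,5). -/

namespace BinaryCode

variable {n : ℕ}

/-- A binary code contains the dual of its dual. -/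
theorem mem_of_forall_orthogonal {B : BinaryCode n} {x : Fin n → ZMod 2}
    (h : ∀ t : Fin n → ZMod 2, (∀ r ∈ B, ∑ i, t i * r i = 0) → ∑ i, t i * x i = 0) : x ∈ B := by
  by_contra hx
  -- A functional separating `x` from `B` is the inner product with the word of its values on the
  -- unit vectors.
  obtain ⟨f, hfx, hf⟩ := Submodule.exists_le_ker_of_notMem hx
  have key : ∀ y : Fin n → ZMod 2, f y = ∑ i, f (Pi.single i 1) * y i := by
    intro y
    conv_lhs => rw [pi_eq_sum_univ' y]
    rw [map_sum]
    refine Finset.sum_congr rfl fun i _ => ?_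
    rw [map_smul, smul_eq_mul, mul_comm]
  refine hfx ?_
  rw [key]
  refine h _ fun r hr => ?_
  rw [← key]
  exact hf hr

end BinaryCode

namespace BinaryCode

/-- The digit of the coordinate that the generator `rmGenerator j` reads, for `j ≠ 0`. -/
def digit : Fin 6 → Fin 32 := ![0, 16, 8, 4, 2, 1]

/-- For `i < j` and for `i = j = 0`, the flat where all generators but `rmGenerator 0`,
`rmGenerator i` and `rmGenerator j` vanish. Summation over these sets is dual to the squarefree
monomials of degree at most two in the generators. -/
def dualFlat (i j : Fin 6) : Finset (Fin 32) :=
  if i < j then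
    if i = 0 then {31, 31 - digit j}
    else {31, 31 - digit i, 31 - digit j, 31 - digit i - digit j}
  else if i = 0 then {31} else ∅

/-- A monomial involving a generator that vanishes on the flat sums to 0. One omitting a free
generator is counted an even number of times. Only the product of all free generators survives.
Since `r² = r`, the square of generator `k` is indexed by `(0, k)`. -/
theorem sum_dualFlat : ∀ i j k l : Fin 6,
    ∑ p ∈ dualFlat i j, rmGenerator k p * rmGenerator l p =
      if (i, j) = (if k = l then (0, k) else (min k l, max k l)) then 1 else 0 := by
  decide +kernel

/-- The squarefree monomials of degree at most two in the generators of `RM(1,5)` are linearly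
independent, so that a word can have prescribed inner products with them. -/
theorem exists_sum_mul_rmGenerator_mul_eq (B : Fin 6 → Fin 6 → ZMod 2)
    (hsymm : ∀ i j, B i j = B j i) (hdiag : ∀ i, B i i = B 0 i) :
    ∃ S : Fin 32 → ZMod 2, ∀ k l, ∑ p, S p * (rmGenerator k p * rmGenerator l p) = B k l := by
  -- The combination of the dual basis with coefficients `B`.
  refine ⟨fun p => ∑ ij : Fin 6 × Fin 6, B ij.1 ij.2 * if p ∈ dualFlat ij.1 ij.2 then 1 else 0,
    fun k l => ?_⟩
  simp only [Finset.sum_mul]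
  rw [Finset.sum_comm]
  have key : ∀ ij : Fin 6 × Fin 6,
      ∑ p, (B ij.1 ij.2 * if p ∈ dualFlat ij.1 ij.2 then 1 else 0) *
        (rmGenerator k p * rmGenerator l p) =
      if ij = (if k = l then (0, k) else (min k l, max k l)) then B ij.1 ij.2 else 0 := by
    intro ij
    have := sum_dualFlat ij.1 ij.2 k l
    simp only [mul_assoc, ← Finset.mul_sum, ite_mul, one_mul, zero_mul, Finset.sum_ite_mem,
      Finset.univ_inter]
    rw [this, mul_ite, mul_one, mul_zero]
  rw [Finset.sum_congr rfl fun ij _ => key ij, Finset.sum_ite_eq' Finset.univ,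
    if_pos (Finset.mem_univ _)]
  split_ifs with h
  · rw [← h, hdiag]
  · rcases le_total k l with hkl | hkl
    · simp [hkl]
    · simp [hkl, hsymm l k]

theorem eq_of_rmGenerator_eq :
    ∀ p q : Fin 32, (∀ j, rmGenerator j p = rmGenerator j q) → p = q := by
  decide +kernel

theorem rmGenerator_mem (j : Fin 6) : rmGenerator j ∈ rmOneFive :=
  Submodule.subset_span ⟨j, rfl⟩

/-- Codewords are affine functions on 𝔽₂⁵: a nonconstant one equals 1 at exactly half of the 32
points. The kernel checks all 64. -/
theorem sixteen_le_card_support_sum_rmGenerator : ∀ a : Fin 6 → ZMod 2,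
    (∑ j, a j • rmGenerator j) ≠ 0 →
    16 ≤ (Finset.univ.filter fun i => (∑ j, a j • rmGenerator j) i ≠ 0).card := by
  decide +kernel

theorem sixteen_le_card_support {r : Fin 32 → ZMod 2} (hr : r ∈ rmOneFive) (h0 : r ≠ 0) :
    16 ≤ (Finset.univ.filter fun i => r i ≠ 0).card := by
  obtain ⟨a, rfl⟩ := (Submodule.mem_span_range_iff_exists_fun _).1 hr
  exact sixteen_le_card_support_sum_rmGenerator a h0

theorem linearIndependent_rmGenerator : LinearIndependent (ZMod 2) rmGenerator := by
  rw [Fintype.linearIndependent_iff]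
  decide +kernel

theorem finrank_rmOneFive : Module.finrank (ZMod 2) rmOneFive = 6 :=
  finrank_span_eq_card linearIndependent_rmGenerator

/-- Five words that separate the `32` coordinates are, up to a permutation of the coordinates,
the nonconstant generators of `RM(1,5)`. -/
theorem exists_perm_of_columns_injective (b : Fin 5 → Fin 32 → ZMod 2)
    (hb : ∀ p q, (∀ j, b j p = b j q) → p = q) :
    ∃ σ : Equiv.Perm (Fin 32), ∀ j p, b j (σ p) = rmGenerator j.succ p := by
  have bij : ∀ c : Fin 5 → Fin 32 → ZMod 2, (∀ p q, (∀ j, c j p = c j q) → p = q) →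
      Function.Bijective fun (p : Fin 32) (j : Fin 5) => c j p := by
    intro c hc
    rw [Fintype.bijective_iff_injective_and_card]
    exact ⟨fun p q h => hc p q fun j => congrFun h j, by simp [ZMod.card]⟩
  have hr : ∀ p q : Fin 32,
      (∀ j : Fin 5, rmGenerator j.succ p = rmGenerator j.succ q) → p = q := by
    intro p q h
    exact eq_of_rmGenerator_eq p q fun j => Fin.cases rfl h j
  refine ⟨(Equiv.ofBijective _ (bij _ hr)).trans (Equiv.ofBijective _ (bij b hb)).symm,
    fun j p => ?_⟩
  exact congrFun ((Equiv.ofBijective _ (bij b hb)).apply_symm_apply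
    (fun j : Fin 5 => rmGenerator j.succ p)) j

/-- A six-dimensional binary code of length `32` that contains the all-one word and has no two
equal coordinates is equivalent to `RM(1,5)`. -/
theorem equivalent_rmOneFive {B : BinaryCode 32} (hdim : Module.finrank (ZMod 2) B = 6)
    (hone : (fun _ => 1) ∈ B) (hcol : ∀ p q, (∀ r ∈ B, r p = r q) → p = q) :
    Equivalent B rmOneFive := by
  set o : B := ⟨fun _ => 1, hone⟩ with ho
  have ho0 : o ≠ 0 := by
    intro h
    exact one_ne_zero (congrFun (congrArg Subtype.val h) (0 : Fin 32))
  -- The all-one word separates no coordinates, so a basis of a complement must already separate all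
  -- of them.
  obtain ⟨W, hW⟩ := Submodule.exists_isCompl (Submodule.span (ZMod 2) {o})
  have hWdim : Module.finrank (ZMod 2) W = 5 := by
    have h1 := Submodule.finrank_add_eq_of_isCompl hW
    rw [finrank_span_singleton ho0, hdim] at h1
    omega
  let w := Module.finBasisOfFinrankEq (ZMod 2) W hWdim
  let b : Fin 5 → Fin 32 → ZMod 2 := fun j => ((w j : B) : Fin 32 → ZMod 2)
  have hB : B = Submodule.span (ZMod 2) (Set.range (Fin.cons (fun _ => 1) b :
      Fin 6 → Fin 32 → ZMod 2)) := by
    refine le_antisymm ?_ (Submodule.span_le.2 ?_)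
    · intro x hx
      have hx' : (⟨x, hx⟩ : B) ∈ Submodule.span (ZMod 2) {o} ⊔ W := by
        rw [hW.sup_eq_top]; trivial
      obtain ⟨y, hy, z, hz, hyz⟩ := Submodule.mem_sup.1 hx'
      obtain ⟨a, rfl⟩ := Submodule.mem_span_singleton.1 hy
      have hxe : x = a • (fun _ => 1) + (z : Fin 32 → ZMod 2) :=
        (congrArg Subtype.val hyz).symm
      have hze : (z : Fin 32 → ZMod 2) = ∑ j, w.repr ⟨z, hz⟩ j • b j := by
        have := congrArg (B.subtype ∘ₗ W.subtype) (w.sum_repr ⟨z, hz⟩)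
        rw [map_sum] at this
        exact this.symm
      rw [hxe, hze]
      refine Submodule.add_mem _ (Submodule.smul_mem _ _ (Submodule.subset_span ⟨0, rfl⟩))
        (Submodule.sum_mem _ fun j _ => Submodule.smul_mem _ _
          (Submodule.subset_span ⟨j.succ, rfl⟩))
    · rintro _ ⟨j, rfl⟩
      refine Fin.cases hone (fun j => ?_) j
      exact (w j : B).2
  obtain ⟨σ, hσ⟩ := exists_perm_of_columns_injective b (by
    intro p q h
    refine hcol p q fun r hr => ?_
    rw [hB] at hr
    induction hr using Submodule.span_induction with
    | mem x hx =>
      obtain ⟨j, rfl⟩ := hx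
      exact Fin.cases rfl h j
    | zero => rfl
    | add x y _ _ hx hy => rw [Pi.add_apply, Pi.add_apply, hx, hy]
    | smul a x _ hx => rw [Pi.smul_apply, Pi.smul_apply, hx])
  refine ⟨σ, ?_⟩
  have hmap : rmOneFive = Submodule.map (LinearMap.funLeft (ZMod 2) (ZMod 2) σ) B := by
    rw [hB, Submodule.map_span, rmOneFive, ← Set.range_comp]
    congr 2
    funext j
    refine Fin.cases rfl (fun j => ?_) j
    funext p
    exact (hσ j p).symm
  rw [hmap, Submodule.map_coe]
  rfl

end BinaryCode

/-! ### Rigidity: the residue code, and uniqueness up to signs. -/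

namespace Z4Code

open BinaryCode

/-- The all-one word lies in the residue code of a Type II code. -/
theorem IsTypeII.one_mem_residue {n : ℕ} {D : Z4Code n} (hD : D.IsTypeII) :
    (fun _ => 1) ∈ D.residue := by
  refine mem_of_forall_orthogonal fun t ht => ?_
  have := hD.norm8_eq_zero (hD.1.double_mem_iff.2 ht)
  rw [norm8_double, fourHom_eq_zero] at this
  simpa using this

/-- Two equal columns `p`, `q` of the residue code would put the word with entries 2 at `p` and `q`
in `D`, of Euclidean weight 8. -/
theorem IsTypeII.residue_equivalent_rmOneFive {D : Z4Code 32} (hD : D.IsTypeII)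
    (hmin : 8 < D.minEuclideanWeight) (hdim : Module.finrank (ZMod 2) D.residue = 6) :
    BinaryCode.Equivalent D.residue rmOneFive := by
  refine equivalent_rmOneFive hdim hD.one_mem_residue fun p q hpq => ?_
  by_contra hne
  set t : Fin 32 → ZMod 2 := fun i => if i ∈ ({p, q} : Finset (Fin 32)) then 1 else 0 with ht
  have hmem : double t ∈ D := by
    refine hD.1.double_mem_iff.2 fun r hr => ?_
    simp only [ht, ite_mul, one_mul, zero_mul, Finset.sum_ite_mem, Finset.univ_inter]
    rw [Finset.sum_pair hne, hpq r hr, CharTwo.add_self_eq_zero]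
  have h0 : double t ≠ 0 := by
    refine double_ne_zero fun h => ?_
    have := congrFun h p
    simp [ht] at this
  have hw : euclideanWeight (double t) = 8 := by
    have : (Finset.univ.filter fun i => t i ≠ 0) = {p, q} := by
      ext i
      simp [ht, or_iff_not_imp_left]
    rw [euclideanWeight_double, this, Finset.card_pair hne]
  have hle : D.minEuclideanWeight ≤ 8 := Nat.sInf_le ⟨_, hmem, h0, hw⟩
  exact absurd hle (not_le.2 hmin)

theorem sum_rmGenerator_mul_eq_zero {t : Fin 32 → ZMod 2}
    (h : ∀ j, ∑ p, t p * rmGenerator j p = 0) : ∀ r ∈ rmOneFive, ∑ p, t p * r p = 0 := by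
  intro r hr
  induction hr using Submodule.span_induction with
  | mem x hx => obtain ⟨j, rfl⟩ := hx; exact h j
  | zero => simp
  | add x y _ _ hx hy => simp [mul_add, Finset.sum_add_distrib, hx, hy]
  | smul a x _ hx => simp [mul_left_comm, ← Finset.mul_sum, hx]

/-- The inner product of two words changes in a controlled way when their lifts change. -/
theorem sum_add_double_mul_add_double {n : ℕ} (x y : Fin n → ZMod 4) (u v : Fin n → ZMod 2) :
    ∑ i, (x + double u) i * (y + double v) i = ∑ i, x i * y i +
      twoHom (∑ i, u i * reduceModTwo y i + ∑ i, v i * reduceModTwo x i) := by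
  rw [map_add, ← sum_double_mul, ← sum_double_mul, ← Finset.sum_add_distrib,
    ← Finset.sum_add_distrib]
  refine Finset.sum_congr rfl fun i _ => ?_
  have : double u i * double v i = 0 := by
    simp only [double]
    generalize u i = a
    generalize v i = b
    revert a b
    decide
  simp only [Pi.add_apply]
  linear_combination this

/-- The sign vector that is `-1` on the support of a binary word. -/
def signOf {n : ℕ} (S : Fin n → ZMod 2) : Fin n → ℤˣ := fun i => if S i = 0 then 1 else -1

theorem signedPerm_signOf {n : ℕ} (S : Fin n → ZMod 2) (x : Fin n → ZMod 4) :
    signedPerm 1 (signOf S) x = x + double (fun i => S i * reduceModTwo x i) := by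
  have key : ∀ (s : ZMod 2) (a : ZMod 4),
      ((((if s = 0 then 1 else -1 : ℤˣ) : ℤˣ) : ℤ) : ZMod 4) * a =
        a + twoHom (s * redHom a) := by
    decide
  funext i
  exact key (S i) (x i)

/-- Two Type II codes with residue code `RM(1,5)` differ by a change of signs. -/
theorem IsTypeII.exists_map_signOf_eq {C D : Z4Code 32} (hC : C.IsTypeII) (hD : D.IsTypeII)
    (hCr : C.residue = rmOneFive) (hDr : D.residue = rmOneFive) :
    ∃ S, D = Submodule.map (signedPerm 1 (signOf S)) C := by
  have hc : ∀ j, ∃ c ∈ C, reduceModTwo c = rmGenerator j := fun j => by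
    rw [← mem_residue, hCr]; exact rmGenerator_mem j
  have hd : ∀ j, ∃ d ∈ D, reduceModTwo d = rmGenerator j := fun j => by
    rw [← mem_residue, hDr]; exact rmGenerator_mem j
  choose c hcC hcr using hc
  choose d hdD hdr using hd
  choose u hu using fun j => exists_add_double ((hdr j).trans (hcr j).symm)
  have hsymm : ∀ i j, ∑ p, u i p * rmGenerator j p = ∑ p, u j p * rmGenerator i p := by
    intro i j
    have h := hD.1.sum_mul_eq_zero (hdD i) (hdD j)
    rw [hu i, hu j, sum_add_double_mul_add_double, hC.1.sum_mul_eq_zero (hcC i) (hcC j), zero_add,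
      twoHom_eq_zero, hcr, hcr] at h
    exact CharTwo.add_eq_zero.1 h
  -- Weights modulo 8 give `u i · r i = ∑ u i`. This is `u i · r 0`, as `r 0` is all-one, and
  -- symmetry turns it into `u 0 · r i`.
  have hdiag : ∀ i, ∑ p, u i p * rmGenerator i p = ∑ p, u 0 p * rmGenerator i p := by
    intro i
    have h := hD.norm8_eq_zero (hdD i)
    rw [hu i, norm8_add_double, hC.norm8_eq_zero (hcC i), zero_add, fourHom_eq_zero, hcr] at h
    rw [CharTwo.add_eq_zero.1 h, hsymm 0 i]
    exact Finset.sum_congr rfl fun p _ => (mul_one _).symm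
  obtain ⟨S, hS⟩ := exists_sum_mul_rmGenerator_mul_eq
    (fun i j => ∑ p, u i p * rmGenerator j p) hsymm hdiag
  refine ⟨S, ?_⟩
  have hC' := hC.map_signedPerm 1 (signOf S)
  set C' := Submodule.map (signedPerm 1 (signOf S)) C with hC'def
  have hC'r : residue C' = rmOneFive := by
    refine SetLike.coe_injective ?_
    rw [hC'def, coe_residue_map_signedPerm, ← hCr]
    simp
  have htors : ∀ t, (∀ j, ∑ p, t p * rmGenerator j p = 0) → double t ∈ C' := fun t ht =>
    hC'.1.double_mem_iff.2 (by rw [hC'r]; exact sum_rmGenerator_mul_eq_zero ht)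
  have hdC' : ∀ j, d j ∈ C' := by
    intro j
    have h1 : signedPerm 1 (signOf S) (c j) ∈ C' := ⟨c j, hcC j, rfl⟩
    -- The discrepancy between `d j` and the sign-changed `c j`; the choice of `S` makes it
    -- orthogonal to every generator.
    have h2 : double (fun p => u j p + S p * rmGenerator j p) ∈ C' := by
      refine htors _ fun k => ?_
      simp only [add_mul, Finset.sum_add_distrib, mul_assoc]
      rw [hS j k, CharTwo.add_self_eq_zero]
    have h3 := C'.add_mem h1 h2
    convert h3 using 1
    rw [hu j, signedPerm_signOf, hcr, add_assoc]
    congr 1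
    funext p
    simp only [double, Pi.add_apply, ← map_add]
    congr 1
    rw [add_comm (u j p), ← add_assoc, CharTwo.add_self_eq_zero, zero_add]
  -- Both codes are self-dual, so one inclusion suffices: `D` is generated by the `d j` and its
  -- doubled words.
  refine hC'.1.eq_of_le hD.1 fun x hx => ?_
  have hxr : reduceModTwo x ∈ rmOneFive := hDr ▸ reduceModTwo_mem_residue hx
  have hE : rmOneFive ≤ residue (Submodule.span (ZMod 4) (Set.range d)) := by
    refine Submodule.span_le.2 ?_
    rintro _ ⟨j, rfl⟩
    exact ⟨d j, Submodule.subset_span ⟨j, rfl⟩, hdr j⟩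
  obtain ⟨y, hy, hyx⟩ := hE hxr
  obtain ⟨t, rfl⟩ := exists_add_double hyx.symm
  have hyD : y ∈ D := (Submodule.span_le.2 (by rintro _ ⟨j, rfl⟩; exact hdD j)) hy
  have hyC : y ∈ C' := (Submodule.span_le.2 (by rintro _ ⟨j, rfl⟩; exact hdC' j)) hy
  have htD : double t ∈ D := (D.add_mem_iff_right hyD).1 hx
  refine C'.add_mem hyC (htors t fun j => ?_)
  exact hD.1.double_mem_iff.1 htD _ (hDr ▸ rmGenerator_mem j)

end Z4Code

/-! ### Construction of the extremal code. -/

namespace Z4Code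

open BinaryCode

/-- The generators of `RM(1,5)`, read as words of `ℤ₄³²` with entries `0` and `1`. -/
def rmLift (j : Fin 6) : Fin 32 → ZMod 4 := fun p => ((rmGenerator j p).val : ZMod 4)

theorem reduceModTwo_rmLift (j : Fin 6) : reduceModTwo (rmLift j) = rmGenerator j := by
  have key : ∀ a : ZMod 2, redHom (a.val : ZMod 4) = a := by decide
  exact funext fun p => key _

/-- Supports of generators meet in 8, 16 or 32 points. -/
theorem sum_rmLift_mul : ∀ j k, ∑ p, rmLift j p * rmLift k p = 0 := by decide +kernel

theorem norm8_rmLift : ∀ j, norm8 (rmLift j) = 0 := by decide +kernel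

theorem euclideanWeight_rmLift_one : euclideanWeight (rmLift 1) = 16 := by decide +kernel

/-- The submodule generated by the lifts of the generators of `RM(1,5)`. -/
def rmSpan : Z4Code 32 := Submodule.span (ZMod 4) (Set.range rmLift)

theorem sum_mul_eq_zero_of_mem_rmSpan {x y : Fin 32 → ZMod 4}
    (h : ∀ j, ∑ p, x p * rmLift j p = 0) (hy : y ∈ rmSpan) : ∑ p, x p * y p = 0 := by
  induction hy using Submodule.span_induction with
  | mem y hy => obtain ⟨j, rfl⟩ := hy; exact h j
  | zero => simp
  | add y z _ _ hy hz => simp [mul_add, Finset.sum_add_distrib, hy, hz]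
  | smul a y _ hy => simp [mul_left_comm, ← Finset.mul_sum, hy]

theorem sum_mul_rmLift_of_mem_rmSpan {x : Fin 32 → ZMod 4} (hx : x ∈ rmSpan) (j : Fin 6) :
    ∑ p, x p * rmLift j p = 0 := by
  simp only [mul_comm (x _)]
  exact sum_mul_eq_zero_of_mem_rmSpan (sum_rmLift_mul j) hx

theorem norm8_eq_zero_of_mem_rmSpan {x : Fin 32 → ZMod 4} (hx : x ∈ rmSpan) : norm8 x = 0 := by
  induction hx using Submodule.span_induction with
  | mem y hy => obtain ⟨j, rfl⟩ := hy; exact norm8_rmLift j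
  | zero => decide +kernel
  | add y z hy hz hy0 hz0 =>
    rw [norm8_add, hy0, hz0,
      sum_mul_eq_zero_of_mem_rmSpan (fun j => sum_mul_rmLift_of_mem_rmSpan hy j) hz]
    decide
  | smul a y _ hy => rw [norm8_smul, hy, mul_zero]

/-- The words whose reduction lies in `RM(1,5)` and that are orthogonal to the lifts of the
generators of `RM(1,5)`. -/
def rmCode : Z4Code 32 where
  carrier := {x | reduceModTwo x ∈ rmOneFive ∧ ∀ j, ∑ p, x p * rmLift j p = 0}
  zero_mem' := ⟨by
    have : reduceModTwo (0 : Fin 32 → ZMod 4) = 0 := by funext i; simp [reduceModTwo]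
    rw [this]; exact zero_mem _, fun j => by simp⟩
  add_mem' := by
    rintro x y ⟨hx, hx'⟩ ⟨hy, hy'⟩
    refine ⟨reduceModTwo_add x y ▸ add_mem hx hy, fun j => ?_⟩
    simp [add_mul, Finset.sum_add_distrib, hx', hy']
  smul_mem' := by
    rintro a x ⟨hx, hx'⟩
    have : reduceModTwo (a • x) = redHom a • reduceModTwo x := by
      funext i; simp [reduceModTwo]
    refine ⟨this ▸ Submodule.smul_mem _ _ hx, fun j => ?_⟩
    simp [mul_assoc, ← Finset.mul_sum, hx']

theorem rmLift_mem (j : Fin 6) : rmLift j ∈ rmCode :=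
  ⟨by rw [reduceModTwo_rmLift]; exact rmGenerator_mem j, sum_rmLift_mul j⟩

theorem double_mem_rmCode {t : Fin 32 → ZMod 2}
    (ht : ∀ r ∈ rmOneFive, ∑ p, t p * r p = 0) : double t ∈ rmCode := by
  refine ⟨by rw [reduceModTwo_double]; exact zero_mem _, fun j => ?_⟩
  rw [sum_double_mul, reduceModTwo_rmLift, ht _ (rmGenerator_mem j), map_zero]

theorem exists_of_mem_rmCode {x : Fin 32 → ZMod 4} (hx : x ∈ rmCode) :
    ∃ y ∈ rmSpan, ∃ t, (∀ r ∈ rmOneFive, ∑ p, t p * r p = 0) ∧ x = y + double t := by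
  have hE : rmOneFive ≤ residue rmSpan := by
    refine Submodule.span_le.2 ?_
    rintro _ ⟨j, rfl⟩
    exact ⟨rmLift j, Submodule.subset_span ⟨j, rfl⟩, reduceModTwo_rmLift j⟩
  obtain ⟨y, hy, hyx⟩ := hE hx.1
  obtain ⟨t, rfl⟩ := exists_add_double hyx.symm
  refine ⟨y, hy, t, sum_rmGenerator_mul_eq_zero fun j => ?_, rfl⟩
  have h := hx.2 j
  simp only [Pi.add_apply, add_mul, Finset.sum_add_distrib] at h
  rwa [sum_mul_rmLift_of_mem_rmSpan hy, zero_add, sum_double_mul, twoHom_eq_zero,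
    reduceModTwo_rmLift] at h

theorem isSelfDual_rmCode : rmCode.IsSelfDual := by
  refine le_antisymm ?_ ?_
  · intro x hx z hz
    obtain ⟨y, hy, t, ht, rfl⟩ := exists_of_mem_rmCode hx
    simp only [Pi.add_apply, add_mul, Finset.sum_add_distrib]
    rw [sum_double_mul, ht _ hz.1, map_zero, add_zero]
    simp only [mul_comm (y _)]
    exact sum_mul_eq_zero_of_mem_rmSpan hz.2 hy
  · intro x hx
    -- Orthogonality to the doubled dual words puts the reduction in the double dual of RM(1,5).
    refine ⟨mem_of_forall_orthogonal fun t ht => ?_, fun j => hx _ (rmLift_mem j)⟩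
    have h := hx _ (double_mem_rmCode ht)
    simp only [mul_comm (x _)] at h
    rwa [sum_double_mul, twoHom_eq_zero] at h

theorem isTypeII_rmCode : rmCode.IsTypeII := by
  refine ⟨isSelfDual_rmCode, fun x hx => ?_⟩
  obtain ⟨y, hy, t, ht, rfl⟩ := exists_of_mem_rmCode hx
  have hone : ∑ p, t p = 0 := by
    have := ht _ (rmGenerator_mem 0)
    simpa [rmGenerator] using this
  have hyr : reduceModTwo y ∈ rmOneFive := by
    have := hx.1
    rwa [reduceModTwo_add, reduceModTwo_double, add_zero] at this
  rw [eight_dvd_euclideanWeight_iff, norm8_add_double, norm8_eq_zero_of_mem_rmSpan hy,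
    ht _ hyr, hone, add_zero, map_zero, add_zero]

theorem residue_rmCode : rmCode.residue = rmOneFive := by
  refine le_antisymm ?_ (Submodule.span_le.2 ?_)
  · rintro _ ⟨x, hx, rfl⟩
    exact hx.1
  · rintro _ ⟨j, rfl⟩
    exact ⟨rmLift j, rmLift_mem j, reduceModTwo_rmLift j⟩

theorem sixteen_le_euclideanWeight {x : Fin 32 → ZMod 4} (hx : x ∈ rmCode) (hx0 : x ≠ 0) :
    16 ≤ euclideanWeight x := by
  by_cases hr : reduceModTwo x = 0
  · obtain ⟨t, rfl⟩ := exists_double_of_reduceModTwo_eq_zero hr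
    by_contra hlt
    have h8 := isTypeII_rmCode.2 _ hx
    have hw0 : euclideanWeight (double t) ≠ 0 := fun h =>
      hx0 (eq_zero_of_euclideanWeight_eq_zero h)
    have hw := euclideanWeight_double t
    -- The weight is a nonzero multiple of 8 below 16, hence 8, which is four times the support
    -- size.
    have hcard : (Finset.univ.filter fun i => t i ≠ 0).card = 2 := by omega
    obtain ⟨p, q, hpq, hsupp⟩ := Finset.card_eq_two.1 hcard
    have ht := isSelfDual_rmCode.double_mem_iff.1 hx
    rw [residue_rmCode] at ht
    have hval : ∀ i, t i = if i ∈ ({p, q} : Finset (Fin 32)) then 1 else 0 := by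
      intro i
      have key : ∀ a : ZMod 2, a = if a ≠ 0 then 1 else 0 := by decide
      rw [← hsupp]
      simpa using key (t i)
    refine hpq (eq_of_rmGenerator_eq p q fun j => ?_)
    have h := ht _ (rmGenerator_mem j)
    simp only [hval, ite_mul, one_mul, zero_mul, Finset.sum_ite_mem, Finset.univ_inter] at h
    rw [Finset.sum_pair hpq] at h
    exact CharTwo.add_eq_zero.1 h
  · exact (sixteen_le_card_support hx.1 hr).trans (card_support_le_euclideanWeight x)

theorem isExtremalTypeII_rmCode : rmCode.IsExtremalTypeII := by
  have hne : rmLift 1 ≠ 0 := by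
    intro h
    have := congrFun h 0
    revert this
    decide
  -- The extremal value is 16, since `32 / 24 = 1`.
  refine ⟨isTypeII_rmCode, le_antisymm ?_ ?_⟩
  · exact Nat.sInf_le ⟨rmLift 1, rmLift_mem 1, hne, euclideanWeight_rmLift_one⟩
  · refine le_csInf ⟨_, rmLift 1, rmLift_mem 1, hne, rfl⟩ ?_
    rintro _ ⟨x, hx, hx0, rfl⟩
    exact sixteen_le_euclideanWeight hx hx0

theorem IsTypeII.rmCode_equivalent {D : Z4Code 32} (hD : D.IsTypeII)
    (hres : BinaryCode.Equivalent D.residue rmOneFive) : Equivalent rmCode D := by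
  obtain ⟨σ, hσ⟩ := hres
  have hD' := hD.map_signedPerm σ 1
  obtain ⟨S, hS⟩ := isTypeII_rmCode.exists_map_signOf_eq hD' residue_rmCode
    (SetLike.coe_injective ((coe_residue_map_signedPerm D σ 1).trans hσ.symm))
  -- The sign change relates `rmCode` to the permuted `D`; undoing `σ` carries the signs along.
  refine ⟨σ.symm, fun i => signOf S (σ.symm i), ?_⟩
  have hinv : ∀ x : Fin 32 → ZMod 4, (fun i => signedPerm σ 1 x (σ.symm i)) = x := by
    intro x; funext i; simp
  ext x
  constructor
  · intro hx
    have h1 : signedPerm σ 1 x ∈ Submodule.map (signedPerm 1 (signOf S)) rmCode :=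
      hS ▸ ⟨x, hx, rfl⟩
    obtain ⟨c, hc, hcx⟩ := h1
    refine ⟨c, hc, ?_⟩
    rw [← hinv x, ← hcx]
    rfl
  · rintro ⟨c, hc, rfl⟩
    have h1 : signedPerm 1 (signOf S) c ∈ Submodule.map (signedPerm σ 1) D :=
      hS.symm ▸ ⟨c, hc, rfl⟩
    obtain ⟨x, hx, hxc⟩ := h1
    have h2 := hinv x
    rw [hxc] at h2
    rw [← h2] at hx
    exact hx

end Z4Code

theorem proposition3 :
    ∃ C : Z4Code 32,
      C.IsExtremalTypeII ∧
      Module.finrank (ZMod 2) C.residue = 6 ∧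
      C.residue = BinaryCode.rmOneFive ∧
      ∀ D : Z4Code 32, D.IsExtremalTypeII → Module.finrank (ZMod 2) D.residue = 6 →
        Z4Code.Equivalent C D ∧ BinaryCode.Equivalent D.residue BinaryCode.rmOneFive := by
  refine ⟨Z4Code.rmCode, Z4Code.isExtremalTypeII_rmCode, ?_, Z4Code.residue_rmCode, ?_⟩
  · rw [Z4Code.residue_rmCode, BinaryCode.finrank_rmOneFive]
  · intro D hD hdim
    have hmin : 8 < D.minEuclideanWeight := by rw [hD.2]; norm_num
    have hres := hD.1.residue_equivalent_rmOneFive hmin hdim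
    exact ⟨hD.1.rmCode_equivalent hres, hres⟩
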